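/- Let $d\ge 1$ and $\gamma=1.4$. For a vector $U=(\rho,\rho u,\rho e)\in\mathbb{R}\times\mathbb{R}^{d}\times\mathbb{R}$ of conservative variables of the compressible Euler equations with $\rho>0$, put $$p(U)=(\gamma-1)\Big(\rho e-\tfrac12\rho|u|^2\Big),\qquad \nu(U)=|u|+\sqrt{\gamma p/\rho},\qquad s(U)=\ln p-\gamma\ln\rho+s_0,$$ with a fixed constant $s_0\in\mathbb{R}$ ($\nu$ and $s$ for states with $\rho>0$, $p>0$), and for $n\in\mathbb{R}^d$ $$F(U)\cdot n=\big(\rho\,u\cdot n,\ \rho\,(u\cdot n)\,u+p\,n,\ (u\cdot n)(\rho e+p)\big).$$ For $\lambda\in\mathbb{R}$ let $$\widehat F_\lambda(U_L,U_R,n)=\tfrac12\big(F(U_L)+F(U_R)\big)\cdot n-\tfrac12\lambda\,(U_R-U_L)$$ be the local Lax--Friedrichs flux with dissipation coefficient $\lambda$. Let $\widehat n\in\mathbb{R}^d$ be an arbitrary unit vector, $\Delta t>0$, $h>0$, and let $U_{e-1},U_e,U_{e+1}$ be three states with positive density and positive pressure. Let the dissipation coefficients at the two faces satisfy $$\lambda_{e-1/2}\ge\max\{\nu(U_{e-1}),\nu(U_e)\},\qquad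 \lambda_{e+1/2}\ge\max\{\nu(U_e),\nu(U_{e+1})\},$$ and the CFL condition $$\frac{\Delta t\,\lambda_{e-1/2}}{h}\le\frac12,\qquad \frac{\Delta t\,\lambda_{e+1/2}}{h}\le\frac12 .$$ (In particular one may take a single $\lambda_{e-1/2}=\lambda_{e+1/2}=\lambda\ge\max_{j\in\{e-1,e,e+1\}}\nu(U_j)$ with $\Delta t\,\lambda/h\le\frac12$.) Then the three-point update along $\widehat n$, $$U_e^{\Delta t}=U_e-\frac{\Delta t}{h}\Big(\widehat F_{\lambda_{e-1/2}}(U_e,U_{e-1},-\widehat n)+\widehat F_{\lambda_{e+1/2}}(U_e,U_{e+1},\widehat n)\Big),$$ has positive density and positive pressure, and $$s(U_e^{\Delta t})\ \ge\ \min_{j\in\{e-1,e,e+1\}}s(U_j).$$ -/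

import Mathlib

noncomputable section

namespace Euler

/-- Ratio of specific heats. -/
def gamma : ℝ := 1.4

/-- Vectors of conservative variables `(ρ, ρu, ρe)` of the compressible Euler equations in `d` space
dimensions. -/
abbrev State (d : ℕ) : Type := ℝ × EuclideanSpace ℝ (Fin d) × ℝ

variable {d : ℕ}

/-- Density `ρ`. -/
def density (U : State d) : ℝ := U.1

/-- Momentum density `ρu`. -/
def momentum (U : State d) : EuclideanSpace ℝ (Fin d) := U.2.1

/-- Total energy density `ρe`. -/
def energy (U : State d) : ℝ := U.2.2

/-- Velocity `u = (ρu)/ρ`. -/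
def velocity (U : State d) : EuclideanSpace ℝ (Fin d) := (density U)⁻¹ • momentum U

/-- Ideal gas law `p = (γ - 1)(ρe - ρ|u|²/2)`. -/
def pressure (U : State d) : ℝ :=
  (gamma - 1) * (energy U - density U * ‖velocity U‖ ^ 2 / 2)

/-- Speed of sound `c = √(γp/ρ)`. -/
def soundSpeed (U : State d) : ℝ := Real.sqrt (gamma * pressure U / density U)

/-- Local maximum characteristic speed `ν = |u| + c`. -/
def maxSpeed (U : State d) : ℝ := ‖velocity U‖ + soundSpeed U

/-- Physical entropy `s = ln p - γ ln ρ + s₀`, with reference entropy `s₀`. -/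
def entropy (s₀ : ℝ) (U : State d) : ℝ :=
  Real.log (pressure U) - gamma * Real.log (density U) + s₀

/-- The Euler flux `F(U) = (ρu, ρu ⊗ u + pI, u(ρe + p))`, an `(d + 2) × d` matrix, contracted with the
direction `n`; here `(ρu ⊗ u) n = ⟨u, n⟩ ρu`. -/
def fluxDot (U : State d) (n : EuclideanSpace ℝ (Fin d)) : State d :=
  (inner ℝ (momentum U) n,
   inner ℝ (velocity U) n • momentum U + pressure U • n,
   inner ℝ (velocity U) n * (energy U + pressure U))

/-- Local Lax–Friedrichs flux `½(F(U_L) + F(U_R))·n - ½λ(U_R - U_L)` with dissipation coefficient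
`lam`. -/
def laxFriedrichsFlux (lam : ℝ) (UL UR : State d) (n : EuclideanSpace ℝ (Fin d)) : State d :=
  (1 / 2 : ℝ) • (fluxDot UL n + fluxDot UR n) - (lam / 2) • (UR - UL)

/-- One step of the three-point first-order scheme along `n`. The neighbours of the cell value `U` are
`Um` (in direction `-n`) and `Up` (in direction `n`); `lamm` and `lamp` are the dissipation
coefficients at the two corresponding faces. -/
def threePointUpdate (dt h lamm lamp : ℝ) (n : EuclideanSpace ℝ (Fin d))
    (Um U Up : State d) : State d :=
  U - (dt / h) • (laxFriedrichsFlux lamm U Um (-n) + laxFriedrichsFlux lamp U Up n)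

end Euler

end

namespace Euler

/-! The update is a convex combination of `U` and two `barState`s, with weights that the CFL
condition makes nonnegative. With K = exp(σ - s₀) and σ the minimal entropy, the set {ρ > 0, p ≥ K
ρ^γ} is convex, so everything reduces to showing that a bar state of two members stays in it
(`barState_mem_invariantSet`).

In the frame moving with the bar state, its energy is 5/2 of its pressure and is linear in the two
data states and their fluxes. Dropping tangential kinetic energy and scaling by λ leaves a
one-dimensional inequality (`bar_energy_ge`) under r ≤ c⁵ and |u| + c ≤ 1, where a and w are the
sound speed of the bar density on the isentrope K and the bar normal velocity. Subtracting a
multiple of mass conservation splits it into one `relEnergy` for each side. The individual terms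
need not be nonnegative, since |w| + a may exceed 1, but their lower bounds contain ±2a⁷w and ±a⁵
max(0, a + |w| - 1)³, which cancel in the sum. Each bound is affine in r, hence reduces to vacuum or
the isentrope r = c⁵, and there to polynomial inequalities for `relForm`. -/

/-! ### Polynomial inequalities for the scaled isentropic form -/

/-- Relative entropy inequality form in the direction of the flow, in units in which the reference
sound speed is one. -/
noncomputable def relForm (y c δ : ℝ) : ℝ :=
  y * (5 * c ^ 7 - 7 * c ^ 5 + 2 + 7 / 5 * c ^ 5 * δ ^ 2) - 2 * δ * (1 - c ^ 7)

/-- The second factor is the cubic Taylor polynomial of (1 - e)^(-5/2) = c⁻⁵ at e = 1 - c² = 0. -/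
theorem pow_five_mul_taylor_le_one {c : ℝ} (hc : 0 ≤ c) :
    c ^ 5 * (1 + 5 / 2 * (1 - c ^ 2) + 35 / 8 * (1 - c ^ 2) ^ 2 + 105 / 16 * (1 - c ^ 2) ^ 3)
      ≤ 1 := by
  have h : 0 ≤ (1 - c) ^ 4 * (1 + 4 * c + 10 * c ^ 2 + 20 * c ^ 3 + 35 * c ^ 4 + 665 / 16 * c ^ 5 +
      105 / 4 * c ^ 6 + 105 / 16 * c ^ 7) := by positivity
  linarith

theorem sq_le_potential {c : ℝ} (hc : 0 ≤ c) : (1 - c) ^ 2 ≤ 5 * c ^ 7 - 7 * c ^ 5 + 2 := by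
  have h : 0 ≤ (1 - c) ^ 2 * (1 + 4 * c + 6 * c ^ 2 + 8 * c ^ 3 + 10 * c ^ 4 + 5 * c ^ 5) := by
    positivity
  linarith

theorem balance_sq_le {s e : ℝ} (hs : 0 ≤ s) (hs1 : s ≤ 1) (he : 0 ≤ e) :
    980 / 27 * (s * e) ^ 3 ≤ (105 / 8 * e ^ 3 * (1 - s) +
      s ^ 3 * (1 + 5 / 2 * e + 35 / 8 * e ^ 2 + 105 / 16 * e ^ 3)) ^ 2 := by
  set N := 1 + 5 / 2 * e + 35 / 8 * e ^ 2 + 105 / 16 * e ^ 3 with hN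
  have hN1 : 1 ≤ N := by rw [hN]; have := pow_nonneg he 3; nlinarith [sq_nonneg e]
  have hA : 0 ≤ 105 / 8 * e ^ 3 * (1 - s) := by
    have := sub_nonneg.2 hs1; positivity
  have hB : 0 ≤ s ^ 3 * N := by positivity
  -- With A, B the two summands, (A + B)² ≥ 4AB suffices exactly when (1 - s)N ≥ 56/81; below that
  -- threshold s is close enough to 1 for B² alone to suffice.
  rcases le_or_gt (56 / 81) ((1 - s) * N) with h | h
  · have : 980 / 27 * (s * e) ^ 3 ≤ 4 * (105 / 8 * e ^ 3 * (1 - s)) * (s ^ 3 * N) := by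
      have h3 : 0 ≤ (s * e) ^ 3 := by positivity
      nlinarith [mul_le_mul_of_nonneg_left h h3]
    nlinarith [sq_nonneg (105 / 8 * e ^ 3 * (1 - s) - s ^ 3 * N)]
  · have h1 : N - 56 / 81 ≤ s * N := by linarith
    have h2 : (N - 56 / 81) ^ 3 ≤ (s * N) ^ 3 := pow_le_pow_left₀ (by linarith) h1 3
    have h3 : 980 / 27 * e ^ 3 * N ≤ (N - 56 / 81) ^ 3 := by
      rw [← sub_nonneg, hN]
      ring_nf
      positivity
    have h4 : 980 / 27 * e ^ 3 * N ≤ s ^ 3 * N ^ 2 * N := by linarith [mul_pow s N 3]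
    have h5 : 980 / 27 * e ^ 3 ≤ s ^ 3 * N ^ 2 := le_of_mul_le_mul_right h4 (by linarith)
    have h6 : 980 / 27 * (s * e) ^ 3 ≤ (s ^ 3 * N) ^ 2 := by
      have := mul_le_mul_of_nonneg_left h5 (pow_nonneg hs 3)
      linarith [mul_pow s e 3, mul_pow (s ^ 3) N 2]
    nlinarith

theorem cubic_balance_nonneg {s e δ : ℝ} (hs : 0 ≤ s) (hs1 : s ≤ 1) (he : 0 ≤ e)
    (hδ : 0 ≤ δ) :
    7 * s * e * δ ≤ 7 / 5 * δ ^ 3 + (105 / 8 * e ^ 3 * (1 - s) +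
      s ^ 3 * (1 + 5 / 2 * e + 35 / 8 * e ^ 2 + 105 / 16 * e ^ 3)) := by
  set B := 105 / 8 * e ^ 3 * (1 - s) +
      s ^ 3 * (1 + 5 / 2 * e + 35 / 8 * e ^ 2 + 105 / 16 * e ^ 3) with hB
  have hB0 : 0 ≤ B := by
    have := sub_nonneg.2 hs1; positivity
  -- m minimises 7/5 δ³ - 7seδ over δ ≥ 0, with minimum -14/5 m³.
  obtain ⟨m, hm0, hm⟩ : ∃ m : ℝ, 0 ≤ m ∧ m ^ 2 = 5 / 3 * (s * e) :=
    ⟨√(5 / 3 * (s * e)), Real.sqrt_nonneg _, Real.sq_sqrt (by positivity)⟩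
  have h : 14 / 5 * m ^ 3 ≤ B := by
    refine le_of_sq_le_sq ?_ hB0
    calc (14 / 5 * m ^ 3) ^ 2 = 196 / 25 * (m ^ 2) ^ 3 := by ring
      _ = 980 / 27 * (s * e) ^ 3 := by rw [hm]; ring
      _ ≤ B ^ 2 := balance_sq_le hs hs1 he
  have h2 : 0 ≤ (δ - m) ^ 2 * (δ + 2 * m) := by positivity
  have h3 : (δ - m) ^ 2 * (δ + 2 * m) = δ ^ 3 - 5 * s * e * δ + 2 * m ^ 3 := by
    linear_combination (-3 * δ) * hm
  linarith

/-- Here s will be the scaled amount by which w - a falls below -1. The delicate case is c ≤ 1, δ ≥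
0: inserting y ≥ 1 - s + δ, completing a square in δ - 5/2 e and using the Taylor bound leaves
`cubic_balance_nonneg`. -/
theorem neg_pow_three_le_relForm {y c δ s : ℝ} (hc : 0 < c) (hcy : c ≤ y) (hy : 1 - s + δ ≤ y)
    (hs : 0 ≤ s) (hs1 : s ≤ 1) : -s ^ 3 ≤ relForm y c δ := by
  have hs3 : 0 ≤ s ^ 3 := by positivity
  have hP := (sq_nonneg (1 - c)).trans (sq_le_potential hc.le)
  have hc5 : 0 < c ^ 5 := by positivity
  have hQ : 0 ≤ 5 * c ^ 7 - 7 * c ^ 5 + 2 + 7 / 5 * c ^ 5 * δ ^ 2 := by positivity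
  unfold relForm
  rcases le_total c 1 with h1 | h1
  · have h7 : c ^ 7 ≤ 1 := pow_le_one₀ hc.le h1
    rcases le_total δ 0 with hδ | hδ
    · nlinarith [mul_nonneg (hc.le.trans hcy) hQ, mul_nonneg (neg_nonneg.2 hδ) (sub_nonneg.2 h7)]
    · have hT := pow_five_mul_taylor_le_one hc.le
      obtain ⟨e, he⟩ : ∃ e, e = 1 - c ^ 2 := ⟨_, rfl⟩
      have he0 : 0 ≤ e := by rw [he]; nlinarith
      have hb := cubic_balance_nonneg hs hs1 he0 hδ
      have hk : (2 * (1 - s) + s ^ 3) *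
          (c ^ 5 * (1 + 5 / 2 * e + 35 / 8 * e ^ 2 + 105 / 16 * e ^ 3)) ≤ 2 * (1 - s) + s ^ 3 := by
        refine mul_le_of_le_one_right (by linarith) ?_
        rw [he]; exact hT
      have hc7 : c ^ 7 = c ^ 5 * (1 - e) := by rw [he]; ring
      have hy' := mul_le_mul_of_nonneg_right hy hQ
      have hsq : 0 ≤ c ^ 5 * ((1 - s) * (7 / 5 * (δ - 5 / 2 * e) ^ 2)) := by
        have := sub_nonneg.2 hs1; positivity
      have hb' := mul_le_mul_of_nonneg_left hb hc5.le
      rw [hc7] at hy' ⊢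
      linarith
  · have h7 : 1 ≤ c ^ 7 := one_le_pow₀ h1
    -- Discriminant condition for the quadratic in δ obtained from y ≥ c.
    have hd : (c ^ 7 - 1) ^ 2 ≤ 7 / 5 * c ^ 7 * (5 * c ^ 7 - 7 * c ^ 5 + 2) := by
      obtain ⟨t, rfl⟩ : ∃ t, c = 1 + t := ⟨c - 1, by ring⟩
      have ht : 0 ≤ t := by linarith
      rw [← sub_nonneg]
      ring_nf
      positivity
    have hcQ : 0 ≤ c * (5 * c ^ 7 - 7 * c ^ 5 + 2 + 7 / 5 * c ^ 5 * δ ^ 2) - 2 * δ * (1 - c ^ 7) := by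
      have h : 0 ≤ 7 / 5 * c ^ 6 *
          (c * (5 * c ^ 7 - 7 * c ^ 5 + 2 + 7 / 5 * c ^ 5 * δ ^ 2) - 2 * δ * (1 - c ^ 7)) := by
        nlinarith [sq_nonneg (7 / 5 * c ^ 6 * δ + (c ^ 7 - 1))]
      exact nonneg_of_mul_nonneg_right h (by positivity)
    nlinarith [mul_le_mul_of_nonneg_right hcy hQ]

theorem pow_three_le_supersonic {e v : ℝ} (he : 0 ≤ e) (hv : 0 ≤ v) (hv1 : v ≤ 1) :
    v ^ 3 ≤ (1 + e) * (5 * (1 + e) ^ 7 - 7 * (1 + e) ^ 5 + 2 + 7 / 5 * (1 + e) ^ 5 * (v + e) ^ 2)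
      - 2 * (v + e) * ((1 + e) ^ 7 - 1) := by
  have h1 : 0 ≤ (v - 4 * e) ^ 2 * (1 - v) := by
    have := sub_nonneg.2 hv1; positivity
  have h2 : 14 / 5 * v ^ 2 * e + 14 / 5 * v * e ^ 2 ≤ 2 / 5 * v ^ 3 + 532 / 5 * e ^ 3 := by
    nlinarith [mul_nonneg hv (sq_nonneg (v - 4 * e)), mul_nonneg he (sq_nonneg (v - 4 * e)),
      mul_nonneg hv (sq_nonneg (v - 5 * e)), pow_nonneg he 3]
  have h3 : 0 ≤ e ^ 2 * (21 * (v - 2 / 3 * e) ^ 2) := by positivity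
  have h4 : 0 ≤ e ^ 3 * (28 * (v - 1 / 4 * e) ^ 2) := by positivity
  have h5 : 0 ≤ v ^ 2 * e ^ 4 * (21 + 42 / 5 * e + 7 / 5 * e ^ 2) := by positivity
  have h6 : 0 ≤ v * e ^ 6 * (14 / 5 + 4 / 5 * e) := by positivity
  have h7 : 0 ≤ e ^ 4 * (1 + e + 112 * e ^ 2 + 172 / 5 * e ^ 3 + 22 / 5 * e ^ 4) := by positivity
  have h8 : 0 ≤ e ^ 4 ∧ 0 ≤ e ^ 5 := ⟨by positivity, by positivity⟩
  linarith [h8.1, h8.2]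

/-- This gain pays for the loss in `neg_pow_three_le_relForm` on the other side. Here z is the
scaled 1 - u, so y + z ≥ 2 encodes a ≤ 1. -/
theorem pow_three_le_relForm {y z c s : ℝ} (hc : 0 < c) (hcy : c ≤ y) (hcz : c ≤ z)
    (hyz : 2 ≤ y + z) (hs : 0 ≤ s) (hs1 : s ≤ 1) : s ^ 3 ≤ relForm y c (-(z - 1 + s)) := by
  have hP := sq_le_potential hc.le
  have hc5 : 0 < c ^ 5 := by positivity
  have hc6 : 0 < c ^ 6 := by positivity
  obtain ⟨d, hd⟩ : ∃ d, d = z - 1 + s := ⟨_, rfl⟩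
  rw [← hd]
  have hP0 := (sq_nonneg (1 - c)).trans hP
  have hQ : 0 ≤ 5 * c ^ 7 - 7 * c ^ 5 + 2 + 7 / 5 * c ^ 5 * d ^ 2 := by positivity
  have hs32 : s ^ 3 ≤ s ^ 2 := by nlinarith [sq_nonneg s]
  rcases le_total c 1 with h1 | h1
  · have h7 : c ^ 7 ≤ 1 := pow_le_one₀ hc.le h1
    rcases le_total d 0 with hd0 | hd0
    · have h0 := neg_pow_three_le_relForm (y := 1 + -d) (δ := -d) hc (by linarith) (by linarith)
        le_rfl zero_le_one
      have hsP : s ^ 3 ≤ s * (5 * c ^ 7 - 7 * c ^ 5 + 2 + 7 / 5 * c ^ 5 * d ^ 2) := by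
        have : s ^ 2 ≤ (1 - c) ^ 2 := pow_le_pow_left₀ hs (by linarith) 2
        have h' : 0 ≤ 7 / 5 * c ^ 5 * d ^ 2 := by positivity
        nlinarith [mul_le_mul_of_nonneg_left (this.trans (hP.trans (le_add_of_nonneg_right h'))) hs]
      unfold relForm at h0 ⊢
      have hy : 1 + s - d ≤ y := by linarith
      nlinarith [mul_le_mul_of_nonneg_right hy hQ]
    · unfold relForm
      rcases le_total d s with hds | hds
      · have hy : 1 ≤ y := by linarith
        have hsd : s ^ 2 ≤ (1 - c + d) ^ 2 := pow_le_pow_left₀ hs (by linarith) 2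
        have key : (1 - c + d) ^ 2 ≤ 5 * c ^ 7 - 7 * c ^ 5 + 2 + 7 / 5 * c ^ 5 * d ^ 2
            + 2 * d * (1 - c ^ 7) := by
          have hd1 : d ≤ 1 := hds.trans hs1
          have h5 : 0 ≤ 4 - c - 28 / 5 * c ^ 4 + 3 * c ^ 6 := by
            nlinarith [mul_nonneg (sub_nonneg.2 h1) hc.le, sq_nonneg (c ^ 3 - 1),
              sq_nonneg (c ^ 2 - 1), sq_nonneg (c ^ 3 - c)]
          have h6 : 0 ≤ d * (c * (4 - c - 28 / 5 * c ^ 4 + 3 * c ^ 6)) := by positivity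
          have h8 := mul_nonneg (sub_nonneg.2 hd1) (sub_nonneg.2 hP)
          rcases le_total 1 (7 / 5 * c ^ 5) with h | h
          · have h9 := mul_nonneg (sub_nonneg.2 h) (sq_nonneg d)
            have h10 : 0 ≤ d * (c * (1 - c ^ 6)) := by
              have := sub_nonneg.2 (pow_le_one₀ hc.le h1 : c ^ 6 ≤ 1); positivity
            linarith
          · have h9 := mul_nonneg (sub_nonneg.2 h) (mul_nonneg hd0 (sub_nonneg.2 hd1))
            linarith
        nlinarith [mul_le_mul_of_nonneg_right hy hQ]
      · have hcc : 2 * c ^ 7 ≤ 7 / 5 * c ^ 6 + 1 := by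
          have : c ^ 6 ≤ 1 := pow_le_one₀ hc.le h1
          nlinarith [mul_le_mul_of_nonneg_left h1 hc6.le]
        have h1' : s ^ 2 ≤ d ^ 2 := pow_le_pow_left₀ hs hds 2
        have h2 : s ^ 2 ≤ d := by nlinarith
        have h3 : 0 ≤ (d - s ^ 2) * (1 - c ^ 7) := mul_nonneg (by linarith) (by linarith)
        have h4 := mul_le_mul_of_nonneg_left hcc (sq_nonneg s)
        nlinarith [mul_le_mul_of_nonneg_right hcy hQ, mul_le_mul_of_nonneg_left h1' hc6.le,
          mul_nonneg hc.le hP0]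
  · have hF : s ^ 3 ≤ c * (5 * c ^ 7 - 7 * c ^ 5 + 2 + 7 / 5 * c ^ 5 * d ^ 2)
        - 2 * d * (c ^ 7 - 1) := by
      obtain ⟨e, rfl⟩ : ∃ e, c = 1 + e := ⟨c - 1, by ring⟩
      have he : 0 ≤ e := by linarith
      -- Since z ≥ c, v = d - e is at least s. For v > 1, compare with v = 1: the quadratic in d
      -- increases beyond d = 1 + e.
      rcases le_total (d - e) 1 with hv | hv
      · have h := pow_three_le_supersonic he (by linarith : 0 ≤ d - e) hv
        rw [sub_add_cancel] at h
        exact (pow_le_pow_left₀ hs (by linarith) 3).trans h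
      · have h := pow_three_le_supersonic he zero_le_one le_rfl
        have h' : 0 ≤ (d - (1 + e)) * ((1 + e) ^ 6 * (7 / 5 * (d - (1 + e)) + 4 / 5 * (1 + e)) + 2) :=
          mul_nonneg (by linarith) (by
            have : 0 ≤ d - (1 + e) := by linarith
            positivity)
        have hs3 : s ^ 3 ≤ 1 := pow_le_one₀ hs hs1
        linarith
    unfold relForm
    linarith [mul_le_mul_of_nonneg_right hcy hQ]

/-! ### One-dimensional energy bound -/

/-- Half-space functional of a right-going one-dimensional state with density `r`, sound speed `c` and
velocity `u`, relative to a reference state of sound speed `a` and velocity `w`. -/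
noncomputable def relEnergy (r c u a w : ℝ) : ℝ :=
  r * ((1 + u) * (5 * c ^ 2 - 7 * a ^ 2 + 7 / 5 * (u - w) ^ 2) + 2 * c ^ 2 * (u - w)) + 2 * a ^ 7

theorem relEnergy_isentropic {a : ℝ} (ha : 0 < a) (c u w : ℝ) :
    relEnergy (c ^ 5) c u a w + 2 * a ^ 7 * w =
      a ^ 8 * relForm ((1 + u) / a) (c / a) ((u - w) / a) := by
  unfold relEnergy relForm
  field_simp
  ring

/-- `relEnergy` is affine in r, so its minimum over [0, c⁵] is at an endpoint; at r = 0 it equals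
2a⁷. -/
theorem le_relEnergy_of_le_isentropic {m r c u a w : ℝ} (hr : 0 ≤ r) (hrc : r ≤ c ^ 5)
    (h0 : m ≤ 2 * a ^ 7) (h1 : m ≤ relEnergy (c ^ 5) c u a w) : m ≤ relEnergy r c u a w := by
  unfold relEnergy at *
  set B := (1 + u) * (5 * c ^ 2 - 7 * a ^ 2 + 7 / 5 * (u - w) ^ 2) + 2 * c ^ 2 * (u - w)
  rcases le_total 0 B with h | h
  · nlinarith [mul_nonneg hr h]
  · nlinarith [mul_le_mul_of_nonpos_right hrc h]

theorem relEnergy_lower_bound_left {r c u a w : ℝ} (hr : 0 ≤ r) (hrc : r ≤ c ^ 5) (hc : 0 < c)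
    (huc : |u| + c ≤ 1) (ha : 0 < a) (hw : -1 ≤ w) :
    -(a ^ 5 * max 0 (a - w - 1) ^ 3) - 2 * a ^ 7 * w ≤ relEnergy r c u a w := by
  have hu := neg_abs_le u
  set s := max 0 (a - w - 1) with hs
  have hs0 : 0 ≤ s := le_max_left _ _
  have hsa : s ≤ a := max_le ha.le (by linarith)
  have ha7 : 0 < a ^ 7 := by positivity
  refine le_relEnergy_of_le_isentropic hr hrc ?_ ?_
  · have : 0 ≤ a ^ 5 * s ^ 3 := by positivity
    nlinarith
  · have h := neg_pow_three_le_relForm (y := (1 + u) / a) (c := c / a) (δ := (u - w) / a)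
      (s := s / a) (by positivity) (by gcongr; linarith) (by
        rw [le_div_iff₀ ha]
        field_simp
        linarith [le_max_right 0 (a - w - 1)]) (by positivity) ((div_le_one ha).2 hsa)
    have h' := mul_le_mul_of_nonneg_left h (by positivity : 0 ≤ a ^ 8)
    rw [← relEnergy_isentropic ha] at h'
    have : a ^ 8 * -(s / a) ^ 3 = -(a ^ 5 * s ^ 3) := by field_simp
    linarith

theorem relEnergy_lower_bound_right {r c u a w : ℝ} (hr : 0 ≤ r) (hrc : r ≤ c ^ 5) (hc : 0 < c)
    (huc : |u| + c ≤ 1) (ha : 0 < a) (ha1 : a ≤ 1) (hw : w ≤ 1) (hw0 : 0 ≤ w) :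
    a ^ 5 * max 0 (a + w - 1) ^ 3 - 2 * a ^ 7 * w ≤ relEnergy r c u a w := by
  have hu := neg_abs_le u
  have hu' := le_abs_self u
  have ha7 : 0 < a ^ 7 := by positivity
  rcases le_total (a + w - 1) 0 with hs | hs
  · rw [max_eq_left hs]
    refine le_relEnergy_of_le_isentropic hr hrc (by nlinarith) ?_
    have h := neg_pow_three_le_relForm (y := (1 + u) / a) (c := c / a) (δ := (u - w) / a)
      (s := 0) (by positivity) (by gcongr; linarith) (by
        rw [le_div_iff₀ ha]
        field_simp
        linarith) le_rfl zero_le_one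
    have h' := mul_le_mul_of_nonneg_left h (by positivity : 0 ≤ a ^ 8)
    rw [← relEnergy_isentropic ha] at h'
    linarith
  · rw [max_eq_right hs]
    have hsa : a + w - 1 ≤ a := by linarith
    refine le_relEnergy_of_le_isentropic hr hrc ?_ ?_
    · have h1 : (a + w - 1) ^ 3 ≤ a ^ 3 := pow_le_pow_left₀ hs hsa 3
      have h2 := mul_le_mul_of_nonneg_left h1 (by positivity : 0 ≤ a ^ 5)
      nlinarith [mul_nonneg ha7.le hw0, mul_le_mul_of_nonneg_left ha1 ha7.le]
    · have h := pow_three_le_relForm (y := (1 + u) / a) (z := (1 - u) / a) (c := c / a)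
        (s := (a + w - 1) / a) (by positivity) (by gcongr; linarith) (by gcongr; linarith) (by
          rw [← add_div, le_div_iff₀ ha]
          linarith) (by positivity) ((div_le_one ha).2 hsa)
      have hd : -((1 - u) / a - 1 + (a + w - 1) / a) = (u - w) / a := by field_simp; ring
      rw [hd] at h
      have h' := mul_le_mul_of_nonneg_left h (by positivity : 0 ≤ a ^ 8)
      rw [← relEnergy_isentropic ha] at h'
      have : a ^ 8 * ((a + w - 1) / a) ^ 3 = a ^ 5 * (a + w - 1) ^ 3 := by field_simp
      linarith

theorem relEnergy_add_relEnergy_nonneg {r₁ c₁ u₁ r₂ c₂ u₂ a w : ℝ}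
    (hr₁ : 0 ≤ r₁) (hrc₁ : r₁ ≤ c₁ ^ 5) (hc₁ : 0 < c₁) (huc₁ : |u₁| + c₁ ≤ 1)
    (hr₂ : 0 ≤ r₂) (hrc₂ : r₂ ≤ c₂ ^ 5) (hc₂ : 0 < c₂) (huc₂ : |u₂| + c₂ ≤ 1)
    (ha : 0 < a) (ha1 : a ≤ 1) (hw : |w| ≤ 1) :
    0 ≤ relEnergy r₁ c₁ u₁ a w + relEnergy r₂ c₂ u₂ a (-w) := by
  obtain ⟨hw1, hw2⟩ := abs_le.1 hw
  rcases le_total 0 w with h | h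
  · have h1 := relEnergy_lower_bound_right hr₁ hrc₁ hc₁ huc₁ ha ha1 hw2 h
    have h2 := relEnergy_lower_bound_left hr₂ hrc₂ hc₂ huc₂ ha (neg_le_neg hw2)
    rw [sub_neg_eq_add] at h2
    linarith
  · have h1 := relEnergy_lower_bound_left hr₁ hrc₁ hc₁ huc₁ ha hw1
    have h2 := relEnergy_lower_bound_right hr₂ hrc₂ hc₂ huc₂ ha ha1 (by linarith : -w ≤ 1)
      (neg_nonneg.2 h)
    rw [← sub_eq_add_neg] at h2
    linarith

theorem mass_flux_le_one {r c u : ℝ} (hrc : r ≤ c ^ 5) (hc : 0 < c)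
    (huc : |u| + c ≤ 1) : r * (1 + u) ≤ 1 := by
  have hu := neg_abs_le u
  have hu' := le_abs_self u
  have h1 : r ≤ 1 - u := by
    have : c ^ 5 ≤ c := pow_le_of_le_one hc.le (by linarith [abs_nonneg u]) (by norm_num)
    linarith
  nlinarith [mul_le_mul_of_nonneg_right h1 (by linarith : 0 ≤ 1 + u), sq_nonneg u]

theorem abs_momentum_flux_le {r c u : ℝ} (hr : 0 ≤ r) (hc : 0 < c) (huc : |u| + c ≤ 1) :
    |r * ((1 + u) * u + 5 / 7 * c ^ 2)| ≤ r * (1 + u) := by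
  have hu := neg_abs_le u
  have hu' := le_abs_self u
  rw [abs_mul, abs_of_nonneg hr]
  refine mul_le_mul_of_nonneg_left (abs_le.2 ⟨?_, ?_⟩) hr
  · nlinarith [sq_nonneg (1 + u), sq_nonneg c]
  · nlinarith [mul_le_mul (by linarith : c ≤ 1 + u) (by linarith : c ≤ 1 - u) hc.le
      (by linarith), sq_nonneg c]

/-- Energy bound for the average state of the one-dimensional Lax–Friedrichs scheme in nondimensional
variables; the right state is reflected. -/
theorem bar_energy_ge {r₁ c₁ u₁ r₂ c₂ u₂ a w : ℝ}
    (hr₁ : 0 < r₁) (hrc₁ : r₁ ≤ c₁ ^ 5) (hc₁ : 0 < c₁) (huc₁ : |u₁| + c₁ ≤ 1)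
    (hr₂ : 0 < r₂) (hrc₂ : r₂ ≤ c₂ ^ 5) (hc₂ : 0 < c₂) (huc₂ : |u₂| + c₂ ≤ 1)
    (ha : 0 < a) (hma : 2 * a ^ 5 = r₁ * (1 + u₁) + r₂ * (1 + u₂))
    (hmo : 2 * a ^ 5 * w = r₁ * ((1 + u₁) * u₁ + 5 / 7 * c₁ ^ 2)
      - r₂ * ((1 + u₂) * u₂ + 5 / 7 * c₂ ^ 2)) :
    10 * a ^ 7 ≤
      r₁ * ((1 + u₁) * (5 * c₁ ^ 2 + 7 / 5 * (u₁ - w) ^ 2) + 2 * c₁ ^ 2 * (u₁ - w)) +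
      r₂ * ((1 + u₂) * (5 * c₂ ^ 2 + 7 / 5 * (u₂ + w) ^ 2) + 2 * c₂ ^ 2 * (u₂ + w)) := by
  have ha5 : 0 < a ^ 5 := by positivity
  have ha1 : a ≤ 1 := by
    refine (pow_le_one_iff_of_nonneg ha.le (by norm_num : 5 ≠ 0)).1 ?_
    linarith [mass_flux_le_one hrc₁ hc₁ huc₁, mass_flux_le_one hrc₂ hc₂ huc₂]
  have hw : |w| ≤ 1 := by
    obtain ⟨h1, h1'⟩ := abs_le.1 (abs_momentum_flux_le hr₁.le hc₁ huc₁)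
    obtain ⟨h2, h2'⟩ := abs_le.1 (abs_momentum_flux_le hr₂.le hc₂ huc₂)
    refine abs_le.2 ⟨?_, ?_⟩ <;> nlinarith
  have h := relEnergy_add_relEnergy_nonneg hr₁.le hrc₁ hc₁ huc₁ hr₂.le hrc₂ hc₂ huc₂ ha ha1 hw
  unfold relEnergy at h
  -- Mass conservation turns the -7a² terms of the two functionals into -14a⁷; their constants add
  -- 4a⁷, leaving the required 10a⁷.
  have hk : 14 * a ^ 7 = 7 * a ^ 2 * (r₁ * (1 + u₁) + r₂ * (1 + u₂)) := by
    rw [← hma]; ring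
  linarith

/-! ### Moving frames and the convex invariant set -/

variable {d : ℕ}

/-- Total energy density in the frame moving with velocity `V`; it is linear in the state. -/
noncomputable def energyInFrame (V : EuclideanSpace ℝ (Fin d)) : State d →ₗ[ℝ] ℝ where
  toFun U := energy U - inner ℝ (momentum U) V + density U * (‖V‖ ^ 2 / 2)
  map_add' U W := by
    simp only [energy, momentum, density, Prod.fst_add, Prod.snd_add, inner_add_left]
    ring
  map_smul' t U := by
    simp only [energy, momentum, density, Prod.smul_fst, Prod.smul_snd, real_inner_smul_left,
      smul_eq_mul, RingHom.id_apply]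
    ring

theorem energyInFrame_apply (V : EuclideanSpace ℝ (Fin d)) (U : State d) :
    energyInFrame V U = energy U - inner ℝ (momentum U) V + density U * (‖V‖ ^ 2 / 2) := rfl

theorem momentum_eq_smul_velocity {U : State d} (hU : density U ≠ 0) :
    momentum U = density U • velocity U := by
  rw [velocity, smul_inv_smul₀ hU]

theorem gamma_sub_one : gamma - 1 = 2 / 5 := by norm_num [gamma]

theorem energyInFrame_eq {U : State d} (hU : density U ≠ 0) (V : EuclideanSpace ℝ (Fin d)) :
    energyInFrame V U = 5 / 2 * pressure U + density U * (‖velocity U - V‖ ^ 2 / 2) := by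
  rw [energyInFrame_apply, momentum_eq_smul_velocity hU, pressure, gamma_sub_one,
    norm_sub_sq_real, real_inner_smul_left]
  ring

theorem energyInFrame_fluxDot {U : State d} (hU : density U ≠ 0)
    (V n : EuclideanSpace ℝ (Fin d)) :
    energyInFrame V (fluxDot U n) =
      inner ℝ (velocity U) n * energyInFrame V U + pressure U * inner ℝ (velocity U - V) n := by
  simp only [energyInFrame_apply, fluxDot, energy, momentum, density, inner_add_left,
    real_inner_smul_left, inner_sub_left]
  have h : inner ℝ U.2.1 n = U.1 * inner ℝ (velocity U) n := by
    have := congrArg (fun x => inner ℝ x n) (momentum_eq_smul_velocity hU)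
    rwa [real_inner_smul_left] at this
  rw [h, real_inner_comm V n]
  ring

/-- States with positive density whose specific entropy is bounded below. -/
def invariantSet (d : ℕ) (K : ℝ) : Set (State d) :=
  {U | 0 < density U ∧ K * density U ^ gamma ≤ pressure U}

/-- In the frame of the combined state its energy is purely internal, while the summands carry extra
nonnegative kinetic energy; convexity of ρ^γ does the rest. -/
theorem convex_invariantSet (d : ℕ) {K : ℝ} (hK : 0 ≤ K) : Convex ℝ (invariantSet d K) := by
  intro U hU W hW s t hs ht hst
  have hρ : density (s • U + t • W) = s • density U + t • density W := rfl
  have hpos : 0 < density (s • U + t • W) := by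
    rw [hρ]
    exact convex_Ioi (0 : ℝ) hU.1 hW.1 hs ht hst
  refine ⟨hpos, ?_⟩
  obtain ⟨V, hV⟩ : ∃ V, V = velocity (s • U + t • W) := ⟨_, rfl⟩
  have h1 := energyInFrame_eq hpos.ne' V
  rw [← hV, sub_self, norm_zero, map_add, map_smul, map_smul, energyInFrame_eq hU.1.ne',
    energyInFrame_eq hW.1.ne', smul_eq_mul, smul_eq_mul] at h1
  have h2 : density (s • U + t • W) ^ gamma ≤ s * density U ^ gamma + t * density W ^ gamma := by
    rw [hρ]
    exact (convexOn_rpow (by norm_num [gamma] : 1 ≤ gamma)).2 (Set.mem_Ici.2 hU.1.le)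
      (Set.mem_Ici.2 hW.1.le) hs ht hst
  have h3 := mul_le_mul_of_nonneg_left h2 hK
  have h4 := mul_le_mul_of_nonneg_left hU.2 hs
  have h5 := mul_le_mul_of_nonneg_left hW.2 ht
  have h6 : 0 ≤ s * (density U * (‖velocity U - V‖ ^ 2 / 2)) := by have := hU.1; positivity
  have h7 : 0 ≤ t * (density W * (‖velocity W - V‖ ^ 2 / 2)) := by have := hW.1; positivity
  linarith

theorem pressure_pos_of_mem_invariantSet {K : ℝ} (hK : 0 < K) {U : State d}
    (hU : U ∈ invariantSet d K) : 0 < pressure U :=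
  (mul_pos hK (Real.rpow_pos_of_pos hU.1 _)).trans_le hU.2

theorem mem_invariantSet_exp_iff {U : State d} (hρ : 0 < density U) (hp : 0 < pressure U)
    (σ s₀ : ℝ) : U ∈ invariantSet d (Real.exp (σ - s₀)) ↔ σ ≤ entropy s₀ U := by
  have h : Real.exp (σ - s₀) * density U ^ gamma =
      Real.exp (σ - s₀ + gamma * Real.log (density U)) := by
    rw [Real.exp_add, Real.rpow_def_of_pos hρ, mul_comm gamma]
  rw [invariantSet, Set.mem_ofPred_eq, h, ← Real.le_log_iff_exp_le hp, entropy]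
  constructor
  · rintro ⟨-, h⟩; linarith
  · intro h; exact ⟨hρ, by linarith⟩

/-! ### Bar states and nondimensionalisation -/

/-- Average state `½(U_L + U_R) - (F(U_R) - F(U_L))·n / (2λ)` of the Lax–Friedrichs flux. -/
noncomputable def barState (lam : ℝ) (L R : State d) (n : EuclideanSpace ℝ (Fin d)) : State d :=
  (1 / 2 : ℝ) • (L + R) - (1 / (2 * lam)) • (fluxDot R n - fluxDot L n)

theorem fluxDot_neg (U : State d) (n : EuclideanSpace ℝ (Fin d)) :
    fluxDot U (-n) = -fluxDot U n := by
  simp only [fluxDot, inner_neg_right, neg_smul, smul_neg, neg_mul, Prod.neg_mk, neg_add]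

theorem threePointUpdate_eq {dt h lamm lamp : ℝ} (hm : lamm ≠ 0) (hp : lamp ≠ 0)
    (n : EuclideanSpace ℝ (Fin d)) (Um U Up : State d) :
    threePointUpdate dt h lamm lamp n Um U Up =
      (1 - dt * lamm / h - dt * lamp / h) • U + (dt * lamm / h) • barState lamm Um U n +
        (dt * lamp / h) • barState lamp U Up n := by
  simp only [threePointUpdate, laxFriedrichsFlux, barState, fluxDot_neg]
  match_scalars <;> field_simp <;> ring

theorem exists_fifth_root {ρ : ℝ} (hρ : 0 < ρ) : ∃ x : ℝ, 0 < x ∧ ρ = x ^ 5 ∧ ρ ^ gamma = x ^ 7 := by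
  have h : ∀ m : ℕ, (ρ ^ (1 / 5 : ℝ)) ^ m = ρ ^ ((m : ℝ) / 5) := fun m => by
    rw [← Real.rpow_mul_natCast hρ.le]
    congr 1
    ring
  refine ⟨ρ ^ (1 / 5 : ℝ), Real.rpow_pos_of_pos hρ _, ?_, ?_⟩
  · rw [h]; norm_num
  · rw [h]; norm_num [gamma]

theorem pressure_eq_soundSpeed {U : State d} (hρ : 0 < density U) (hp : 0 ≤ pressure U) :
    pressure U = 5 / 7 * (density U * soundSpeed U ^ 2) := by
  rw [soundSpeed, Real.sq_sqrt (by have : 0 < gamma := by norm_num [gamma]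
                                   positivity), gamma]
  field_simp
  ring

/-- On the isentrope p = K ρ^γ the sound speed at ρ = k⁵ is exactly `lam`, so the entropy bound
becomes r ≤ c⁵ in scaled variables. -/
theorem density_le_of_mem_invariantSet {K lam k : ℝ} (hK : 0 < K) (hlam : 0 < lam) (hk : 0 < k)
    (hkK : 7 / 5 * K * k ^ 2 = lam ^ 2) {U : State d} (hU : U ∈ invariantSet d K) :
    density U / k ^ 5 ≤ (soundSpeed U / lam) ^ 5 := by
  obtain ⟨x, hx, hρ, hγ⟩ := exists_fifth_root hU.1
  have h := hU.2
  rw [pressure_eq_soundSpeed hU.1 (pressure_pos_of_mem_invariantSet hK hU).le, hγ, hρ] at h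
  have h1 : 7 / 5 * K * x ^ 2 ≤ soundSpeed U ^ 2 :=
    le_of_mul_le_mul_left (by linarith) (by positivity : 0 < x ^ 5)
  have hc : 0 ≤ soundSpeed U := Real.sqrt_nonneg _
  have h2 : (x / k) ^ 2 ≤ (soundSpeed U / lam) ^ 2 := by
    rw [div_pow, div_pow, ← hkK, div_le_div_iff₀ (by positivity) (by positivity)]
    nlinarith [mul_le_mul_of_nonneg_right h1 (sq_nonneg k)]
  rw [hρ, ← div_pow]
  exact pow_le_pow_left₀ (by positivity) (le_of_sq_le_sq h2 (by positivity)) 5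

theorem sq_inner_le_sq_norm {n : EuclideanSpace ℝ (Fin d)} (hn : ‖n‖ = 1)
    (v : EuclideanSpace ℝ (Fin d)) : inner ℝ v n ^ 2 ≤ ‖v‖ ^ 2 := by
  rw [sq_le_sq, abs_norm]
  simpa [hn] using abs_real_inner_le_norm v n

theorem soundSpeed_pos {U : State d} (hρ : 0 < density U) (hp : 0 < pressure U) :
    0 < soundSpeed U := by
  have : 0 < gamma := by norm_num [gamma]
  exact Real.sqrt_pos.2 (by positivity)

theorem maxSpeed_pos {U : State d} (hρ : 0 < density U) (hp : 0 < pressure U) : 0 < maxSpeed U :=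
  add_pos_of_nonneg_of_pos (norm_nonneg _) (soundSpeed_pos hρ hp)

theorem normal_mach_bound {n : EuclideanSpace ℝ (Fin d)} (hn : ‖n‖ = 1) {lam : ℝ} (hlam : 0 < lam)
    {U : State d} (hU : maxSpeed U ≤ lam) :
    |inner ℝ (velocity U) n / lam| + soundSpeed U / lam ≤ 1 := by
  rw [abs_div, abs_of_pos hlam, ← add_div, div_le_one hlam]
  have : |inner ℝ (velocity U) n| ≤ ‖velocity U‖ := by
    simpa [hn] using abs_real_inner_le_norm (velocity U) n
  exact (add_le_add_left this _).trans hU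

theorem barState_mem_invariantSet {K lam : ℝ} (hK : 0 < K) {n : EuclideanSpace ℝ (Fin d)}
    (hn : ‖n‖ = 1) {L R : State d} (hL : L ∈ invariantSet d K) (hR : R ∈ invariantSet d K)
    (hνL : maxSpeed L ≤ lam) (hνR : maxSpeed R ≤ lam) :
    barState lam L R n ∈ invariantSet d K := by
  have hpL := pressure_pos_of_mem_invariantSet hK hL
  have hpR := pressure_pos_of_mem_invariantSet hK hR
  have hlam : 0 < lam := (maxSpeed_pos hL.1 hpL).trans_le hνL
  obtain ⟨k, hk, hkK⟩ : ∃ k : ℝ, 0 < k ∧ 7 / 5 * K * k ^ 2 = lam ^ 2 := by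
    refine ⟨lam * √(5 / (7 * K)), by positivity, ?_⟩
    rw [mul_pow, Real.sq_sqrt (by positivity)]
    field_simp
  have hrL := density_le_of_mem_invariantSet hK hlam hk hkK hL
  have hrR := density_le_of_mem_invariantSet hK hlam hk hkK hR
  have hmL := normal_mach_bound hn hlam hνL
  have hmR := normal_mach_bound hn hlam hνR
  have hcL := div_pos (soundSpeed_pos hL.1 hpL) hlam
  have hcR := div_pos (soundSpeed_pos hR.1 hpR) hlam
  have hpL' := pressure_eq_soundSpeed hL.1 hpL.le
  have hpR' := pressure_eq_soundSpeed hR.1 hpR.le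
  have hrL0 := div_pos hL.1 (by positivity : 0 < k ^ 5)
  have hrR0 := div_pos hR.1 (by positivity : 0 < k ^ 5)
  obtain ⟨rL, erL⟩ : ∃ r, r = density L / k ^ 5 := ⟨_, rfl⟩
  obtain ⟨rR, erR⟩ : ∃ r, r = density R / k ^ 5 := ⟨_, rfl⟩
  obtain ⟨cL, ecL⟩ : ∃ c, c = soundSpeed L / lam := ⟨_, rfl⟩
  obtain ⟨cR, ecR⟩ : ∃ c, c = soundSpeed R / lam := ⟨_, rfl⟩
  obtain ⟨uL, euL⟩ : ∃ u, u = inner ℝ (velocity L) n / lam := ⟨_, rfl⟩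
  obtain ⟨uR, euR⟩ : ∃ u, u = inner ℝ (velocity R) n / lam := ⟨_, rfl⟩
  rw [← erL] at hrL hrL0
  rw [← erR] at hrR hrR0
  rw [← ecL] at hrL hmL hcL
  rw [← ecR] at hrR hmR hcR
  rw [← euL] at hmL
  -- The right state is reflected, so its scaled velocity enters as -uR.
  rw [← euR, ← abs_neg] at hmR
  have hρL : density L = k ^ 5 * rL := by rw [erL]; field_simp
  have hρR : density R = k ^ 5 * rR := by rw [erR]; field_simp
  have hvL : inner ℝ (velocity L) n = lam * uL := by rw [euL]; field_simp
  have hvR : inner ℝ (velocity R) n = lam * uR := by rw [euR]; field_simp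
  have hsL : soundSpeed L = lam * cL := by rw [ecL]; field_simp
  have hsR : soundSpeed R = lam * cR := by rw [ecR]; field_simp
  rw [hρL, hsL] at hpL'
  rw [hρR, hsR] at hpR'
  have hmomL : inner ℝ (momentum L) n = k ^ 5 * rL * (lam * uL) := by
    rw [momentum_eq_smul_velocity hL.1.ne', real_inner_smul_left, hρL, hvL]
  have hmomR : inner ℝ (momentum R) n = k ^ 5 * rR * (lam * uR) := by
    rw [momentum_eq_smul_velocity hR.1.ne', real_inner_smul_left, hρR, hvR]
  obtain ⟨B, hB⟩ : ∃ B, B = barState lam L R n := ⟨_, rfl⟩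
  rw [← hB]
  have hden : 2 * density B = k ^ 5 * (rL * (1 + uL) + rR * (1 + -uR)) := by
    have : density B = 1 / 2 * (density L + density R)
        - 1 / (2 * lam) * (inner ℝ (momentum R) n - inner ℝ (momentum L) n) := by rw [hB]; rfl
    rw [this, hmomL, hmomR, hρL, hρR]
    field_simp
    ring
  have hnn : inner ℝ n n = (1 : ℝ) := by rw [real_inner_self_eq_norm_sq, hn, one_pow]
  have hmom : 2 * inner ℝ (momentum B) n = lam * k ^ 5 *
      (rL * ((1 + uL) * uL + 5 / 7 * cL ^ 2) - rR * ((1 + -uR) * -uR + 5 / 7 * cR ^ 2)) := by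
    have : momentum B = (1 / 2 : ℝ) • (momentum L + momentum R) - (1 / (2 * lam)) •
        ((inner ℝ (velocity R) n • momentum R + pressure R • n) -
          (inner ℝ (velocity L) n • momentum L + pressure L • n)) := by rw [hB]; rfl
    rw [this]
    simp only [inner_sub_left, inner_add_left, real_inner_smul_left, hmomL, hmomR, hvL, hvR, hnn,
      hpL', hpR']
    field_simp
    ring
  have hBpos : 0 < density B := by
    have h1 : 0 < 1 + uL := by linarith [neg_abs_le uL]
    have h2 : 0 < 1 + -uR := by linarith [neg_abs_le (-uR)]
    have : 0 < k ^ 5 * (rL * (1 + uL) + rR * (1 + -uR)) := by positivity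
    linarith
  refine ⟨hBpos, ?_⟩
  obtain ⟨x, hx, hBx, hBγ⟩ := exists_fifth_root hBpos
  obtain ⟨a, rfl⟩ : ∃ a, x = k * a := ⟨x / k, by field_simp⟩
  have ha : 0 < a := pos_of_mul_pos_right hx hk.le
  obtain ⟨V, hV⟩ : ∃ V, V = velocity B := ⟨_, rfl⟩
  obtain ⟨w, ew⟩ : ∃ w, w = inner ℝ V n / lam := ⟨_, rfl⟩
  have hw : inner ℝ V n = lam * w := by rw [ew]; field_simp
  have hk5 : k ^ 5 ≠ 0 := by positivity
  have hma : 2 * a ^ 5 = rL * (1 + uL) + rR * (1 + -uR) := by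
    rw [hBx] at hden
    exact mul_left_cancel₀ hk5 (by linarith)
  have hmo : 2 * a ^ 5 * w = rL * ((1 + uL) * uL + 5 / 7 * cL ^ 2)
      - rR * ((1 + -uR) * -uR + 5 / 7 * cR ^ 2) := by
    rw [momentum_eq_smul_velocity hBpos.ne', real_inner_smul_left, ← hV, hw, hBx] at hmom
    exact mul_left_cancel₀ (mul_ne_zero hlam.ne' hk5) (by linarith)
  have hbar := bar_energy_ge hrL0 hrL hcL hmL hrR0 hrR hcR hmR ha hma hmo
  have hE : 5 / 2 * pressure B =
      1 / 2 * ((1 + uL) * energyInFrame V L + pressure L * (uL - w)) +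
      1 / 2 * ((1 - uR) * energyInFrame V R - pressure R * (uR - w)) := by
    have h := energyInFrame_eq hBpos.ne' V
    rw [← hV, sub_self, norm_zero] at h
    have h' : energyInFrame V B = 1 / 2 * (energyInFrame V L + energyInFrame V R) -
        1 / (2 * lam) * (energyInFrame V (fluxDot R n) - energyInFrame V (fluxDot L n)) := by
      rw [hB, barState, map_sub, map_smul, map_smul, map_add, map_sub, smul_eq_mul, smul_eq_mul]
    rw [energyInFrame_fluxDot hL.1.ne', energyInFrame_fluxDot hR.1.ne', inner_sub_left,
      inner_sub_left, hvL, hvR, hw] at h'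
    have h'' : 5 / 2 * pressure B = energyInFrame V B := by linarith
    rw [h'', h']
    field_simp
    ring
  -- Only the normal part of the relative kinetic energy is kept.
  have hEL : 5 / 2 * pressure L + density L * (lam ^ 2 * (uL - w) ^ 2 / 2) ≤ energyInFrame V L := by
    rw [energyInFrame_eq hL.1.ne']
    have h := sq_inner_le_sq_norm hn (velocity L - V)
    rw [inner_sub_left, hvL, hw] at h
    have := mul_le_mul_of_nonneg_left h hL.1.le
    linarith
  have hER : 5 / 2 * pressure R + density R * (lam ^ 2 * (uR - w) ^ 2 / 2) ≤ energyInFrame V R := by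
    rw [energyInFrame_eq hR.1.ne']
    have h := sq_inner_le_sq_norm hn (velocity R - V)
    rw [inner_sub_left, hvR, hw] at h
    have := mul_le_mul_of_nonneg_left h hR.1.le
    linarith
  have hEL' := mul_le_mul_of_nonneg_left hEL (by linarith [neg_abs_le uL] : 0 ≤ 1 + uL)
  have hER' := mul_le_mul_of_nonneg_left hER (by linarith [neg_abs_le (-uR)] : 0 ≤ 1 - uR)
  rw [hρL, hpL'] at hEL'
  rw [hρR, hpR'] at hER'
  rw [hpL', hpR'] at hE
  have hfin := mul_le_mul_of_nonneg_left hbar (by positivity : 0 ≤ k ^ 5 * lam ^ 2)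
  have hKB : K * (k * a) ^ 7 = 5 / 7 * (k ^ 5 * lam ^ 2) * a ^ 7 := by
    rw [← hkK]; ring
  rw [hBγ, hKB]
  linarith

end Euler

/-! ### Minimum entropy principle for the update -/

theorem lemma2 {d : ℕ} (n : EuclideanSpace ℝ (Fin d)) (hn : ‖n‖ = 1)
    (s₀ dt h lamm lamp : ℝ) (hdt : 0 < dt) (hh : 0 < h)
    (Um U Up : Euler.State d)
    (hρm : 0 < Euler.density Um) (hρ : 0 < Euler.density U) (hρp : 0 < Euler.density Up)
    (hpm : 0 < Euler.pressure Um) (hp : 0 < Euler.pressure U) (hpp : 0 < Euler.pressure Up)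
    (hlamm : max (Euler.maxSpeed Um) (Euler.maxSpeed U) ≤ lamm)
    (hlamp : max (Euler.maxSpeed U) (Euler.maxSpeed Up) ≤ lamp)
    (hCFLm : dt * lamm / h ≤ 1 / 2) (hCFLp : dt * lamp / h ≤ 1 / 2) :
    0 < Euler.density (Euler.threePointUpdate dt h lamm lamp n Um U Up) ∧
    0 < Euler.pressure (Euler.threePointUpdate dt h lamm lamp n Um U Up) ∧
    min (Euler.entropy s₀ Um) (min (Euler.entropy s₀ U) (Euler.entropy s₀ Up)) ≤
      Euler.entropy s₀ (Euler.threePointUpdate dt h lamm lamp n Um U Up) := by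
  obtain ⟨hm₁, hm₂⟩ := max_le_iff.1 hlamm
  obtain ⟨hp₁, hp₂⟩ := max_le_iff.1 hlamp
  have hm0 : 0 < lamm := (Euler.maxSpeed_pos hρ hp).trans_le hm₂
  have hp0 : 0 < lamp := (Euler.maxSpeed_pos hρ hp).trans_le hp₁
  obtain ⟨σ, hσ⟩ : ∃ σ, σ = min (Euler.entropy s₀ Um)
      (min (Euler.entropy s₀ U) (Euler.entropy s₀ Up)) := ⟨_, rfl⟩
  have hK := Real.exp_pos (σ - s₀)
  have hUm := (Euler.mem_invariantSet_exp_iff hρm hpm σ s₀).2 (hσ.trans_le (min_le_left _ _))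
  have hU := (Euler.mem_invariantSet_exp_iff hρ hp σ s₀).2
    (hσ.trans_le ((min_le_right _ _).trans (min_le_left _ _)))
  have hUp := (Euler.mem_invariantSet_exp_iff hρp hpp σ s₀).2
    (hσ.trans_le ((min_le_right _ _).trans (min_le_right _ _)))
  have hbm := Euler.barState_mem_invariantSet hK hn hUm hU hm₁ hm₂
  have hbp := Euler.barState_mem_invariantSet hK hn hU hUp hp₁ hp₂
  have hmem : Euler.threePointUpdate dt h lamm lamp n Um U Up ∈
      Euler.invariantSet d (Real.exp (σ - s₀)) := by
    rw [Euler.threePointUpdate_eq hm0.ne' hp0.ne']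
    have := (Euler.convex_invariantSet d hK.le).sum_mem (t := Finset.univ)
      (w := ![1 - dt * lamm / h - dt * lamp / h, dt * lamm / h, dt * lamp / h])
      (z := ![U, Euler.barState lamm Um U n, Euler.barState lamp U Up n])
      (by
        intro i _
        fin_cases i
        · simp only [Fin.zero_eta, Matrix.cons_val_zero]; linarith
        · exact (by positivity : 0 ≤ dt * lamm / h)
        · exact (by positivity : 0 ≤ dt * lamp / h))
      (by simp [Fin.sum_univ_three]; ring)
      (by
        intro i _
        fin_cases i
        · exact hU
        · exact hbm
        · exact hbp)
    simpa [Fin.sum_univ_three] using this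
  have hpos := Euler.pressure_pos_of_mem_invariantSet hK hmem
  exact ⟨hmem.1, hpos, hσ ▸ (Euler.mem_invariantSet_exp_iff hmem.1 hpos σ s₀).1 hmem⟩
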